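/- Let $k$ be a field. For a finite poset $S$, an $S$-space is $\mathbf V=(V,V(s))_{s\in S}$, where $V$ is a finite-dimensional $k$-vector space and the $V(s)$ are subspaces of $V$ with $V(s)\subseteq V(t)$ whenever $s\le t$; a morphism $f:\mathbf U\to\mathbf V$ is a $k$-linear map $f:U\to V$ with $f(U(s))\subseteq V(s)$ for all $s$. Direct sums are formed componentwise. A morphism $f:\mathbf U\to\mathbf V$ is proper if $f(U(s))=V(s)\cap f(U)$ for all $s$. An $S$-space $\mathbf I$ is injective if every morphism $\mathbf U\to\mathbf I$ extends along every proper monomorphism $\mathbf U\to\mathbf V$. A monomorphism $f:\mathbf U\to\mathbf V$ is essential if, for every morphism $h:\mathbf V\to\mathbf X$, $h$ is a proper monomorphism if and only if $hf$ is; an injective envelope is an essential monomorphism into an injective space. An $S$-space $\mathbf V$ is trivial at $p$ if $V(p)=0$. For a subset $T$ of a poset $P$ (with the induced order), $\mathrm{res}^P_T$ forgets the subspaces indexed by $P\setminus T$; $\mathrm{ind}_T^P$ and $\mathrm{coind}_T^P$ keep the ambient space and the linear maps, and put at $s\in P$ the subspace $\sum_{t\in T,\,t\le s}V(t)$, respectively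 $\bigcap_{t\in T,\,s\le t}V(t)$ (which is $0$, respectively $V$, if there is no such $t$). For $p\in P$, $E^p\mathbf V$ is the $P$-space with ambient space $V(p)$ and subspaces $V(s)\cap V(p)$ (on morphisms, $E^p$ is restriction to $V(p)$), and $\pi_p(\mathbf V):\mathbf V\to E_p\mathbf V$ is the projection onto the $P$-space with ambient space $V/V(p)$ and subspaces $(V(s)+V(p))/V(p)$. An ideal of a poset is a down-closed subset (possibly empty), and the width $w(T)$ is the largest cardinality of an antichain in $T$. Let $\check a(S)$ be the set of nonempty antichains of $S$, ordered by $A\le B$ if and only if every $a\in A$ satisfies $a\le b$ for some $b\in B$; identify $s\in S$ with $\{s\}$. For $R\subseteq S$, let $S^R=R\cup\check a(S\setminus R)$, a subposet of $\check a(S)$ containing $S$. **Proposition.** Let $R$ be an ideal of a finite poset $S$ with $w(S\setminus R)\le 2$, let $J$ be an ideal of $S^R$ that does not contain $R$, and let $p\in R\setminus J$. For a $J$-space $\mathbf W$ with ambient space $W$, let $$g:\mathrm{res}^{S^R}_{\check a(S\setminus R)}\mathrm{coind}_J^{S^R}\mathbf W\to\mathbf I$$ be a proper monomorphism into an injective $\check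 a(S\setminus R)$-space $\mathbf I=(I,I(t))$, given by a linear map $g:W\to I$. Write $\mathrm{coind}_J^{S^R}\mathbf W=(W,W'(t))_{t\in S^R}$, and put $\mathbf I^g=(Y,Y(t))_{t\in S^R}$ with $Y=I$, $Y(t)=I(t)$ for $t\in\check a(S\setminus R)$ and $Y(r)=g(W'(r))$ for $r\in R$. (a) $\mathbf I^g$ is an $S^R$-space with $\mathrm{res}^{S^R}_{\check a(S\setminus R)}\mathbf I^g=\mathbf I$, and the linear map $g$ gives a proper monomorphism $\check g:\mathrm{coind}_J^{S^R}\mathbf W\to\mathbf I^g$ with $\mathrm{res}^{S^R}_{\check a(S\setminus R)}\check g=g$. Moreover, $\pi_p(\mathbf I^g):\mathbf I^g\to E_p\mathbf I^g$ is a cokernel of $\check g$, and $\check g$ is a kernel of $\pi_p(\mathbf I^g)$. (b) There is an $S$-space $\mathbf V$, unique up to isomorphism, with $\mathbf I^g\cong\mathrm{ind}_S^{S^R}\mathbf V$, and it satisfies $\mathbf W\cong\mathrm{res}_J^{S^R}E^p\,\mathrm{ind}_S^{S^R}\mathbf V$. (c) For every morphism $\alpha:\mathbf U\to\mathbf V$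 of $S$-spaces, $\mathrm{res}_J^{S^R}E^p\,\mathrm{ind}_S^{S^R}\alpha=0$ if and only if $\alpha$ factors through an $S$-space trivial at $p$. (d) The morphism $g$ is an injective envelope if and only if the $S$-space $\mathbf V$ of (b) has no nonzero direct summand trivial at $p$. The functor $\mathrm{res}_J^{S^R}E^p\,\mathrm{ind}_S^{S^R}$ from $S$-spaces to $J$-spaces is additive, and its restriction to the full subcategory of $S$-spaces with no nonzero direct summand trivial at $p$ is dense, that is, every $J$-space is isomorphic to the image of an object of this subcategory. -/

import Mathlib

open CategoryTheory CategoryTheory.Limits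

universe u w

/-! ### Posets: width, antichains, the poset `S^R` -/

/-- The width of a poset: the supremum of the cardinalities of its antichains. -/
noncomputable def posetWidth (S : Type w) [PartialOrder S] : ℕ∞ :=
  ⨆ A : {A : Set S // IsAntichain (· ≤ ·) A}, A.1.encard

/-- The nonempty antichains of a poset `S`. With the order below this is the poset `ǎ(S)`. -/
@[ext]
structure CheckAntichain (S : Type w) [PartialOrder S] where
  carrier : Set S
  isAntichain : IsAntichain (· ≤ ·) carrier
  nonempty : carrier.Nonempty

namespace CheckAntichain

variable {S : Type w} [PartialOrder S]

/-- `A ≤ B` if and only if every element of `A` lies below some element of `B`. -/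
instance : PartialOrder (CheckAntichain S) where
  le A B := ∀ a ∈ A.carrier, ∃ b ∈ B.carrier, a ≤ b
  le_refl A a ha := ⟨a, ha, le_rfl⟩
  le_trans A B C hAB hBC a ha := by
    obtain ⟨b, hb, hab⟩ := hAB a ha
    obtain ⟨c, hc, hbc⟩ := hBC b hb
    exact ⟨c, hc, hab.trans hbc⟩
  le_antisymm A B hAB hBA := by
    have key : ∀ X Y : CheckAntichain S,
        (∀ a ∈ X.carrier, ∃ b ∈ Y.carrier, a ≤ b) →
        (∀ a ∈ Y.carrier, ∃ b ∈ X.carrier, a ≤ b) → X.carrier ⊆ Y.carrier := by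
      intro X Y hXY hYX a ha
      obtain ⟨b, hb, hab⟩ := hXY a ha
      obtain ⟨c, hc, hbc⟩ := hYX b hb
      have hac : a = c := X.isAntichain.eq ha hc (hab.trans hbc)
      subst hac
      rwa [le_antisymm hab hbc]
    exact CheckAntichain.ext (Set.Subset.antisymm (key A B hAB hBA) (key B A hBA hAB))

/-- The one-element antichain `{s}`. -/
def single (s : S) : CheckAntichain S where
  carrier := {s}
  isAntichain := Set.subsingleton_singleton.isAntichain _
  nonempty := Set.singleton_nonempty s

end CheckAntichain

/-- The poset `S^R = R ∪ ǎ(S \ R)`, a subposet of `ǎ(S)`: its elements are the one-element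
antichains `{r}` with `r ∈ R` and the nonempty antichains contained in `S \ R`. -/
abbrev UpperExt {S : Type w} [PartialOrder S] (R : Set S) : Type w :=
  {A : CheckAntichain S // (∃ r ∈ R, A = CheckAntichain.single r) ∨ A.carrier ⊆ Rᶜ}

namespace UpperExt

variable {S : Type w} [PartialOrder S] (R : Set S)

/-- The inclusion of `S` into `S^R`, identifying `s` with `{s}`. -/
def incl : S ↪o UpperExt R where
  toFun s := ⟨CheckAntichain.single s, by
    by_cases hs : s ∈ R
    · exact Or.inl ⟨s, hs, rfl⟩
    · exact Or.inr (Set.singleton_subset_iff.mpr hs)⟩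
  inj' s t h := by
    have h' : ({s} : Set S) = {t} := congrArg (fun A => A.1.carrier) h
    exact Set.singleton_injective h'
  map_rel_iff' {s t} := by
    constructor
    · intro h
      obtain ⟨b, hb, hab⟩ := h s (Set.mem_singleton s)
      rwa [Set.mem_singleton_iff.mp hb] at hab
    · intro h a ha
      exact ⟨t, Set.mem_singleton t, (Set.mem_singleton_iff.mp ha).trans_le h⟩

/-- The subposet `ǎ(S \ R)` of `S^R`. -/
def check : Set (UpperExt R) := {A | A.1.carrier ⊆ Rᶜ}

theorem isUpperSet_check {R : Set S} (hR : IsLowerSet R) : IsUpperSet (check R) := by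
  rintro A B hAB hA
  rcases B.2 with ⟨r, hr, hB⟩ | hB
  · obtain ⟨a, ha⟩ := A.1.nonempty
    obtain ⟨b, hb, hab⟩ := hAB a ha
    rw [hB] at hb
    rw [Set.mem_singleton_iff.mp hb] at hab
    exact absurd (hR hab hr) (hA ha)
  · exact hB

end UpperExt

/-- The inclusion of a subset `T` of a poset, viewed as a subposet. -/
abbrev subposet {P : Type w} [PartialOrder P] (T : Set P) : T ↪o P :=
  OrderEmbedding.subtype (· ∈ T)

/-! ### The category of `S`-spaces -/

/-- An `S`-space over the field `k`. -/
structure PosetSpace (k : Type u) [Field k] (S : Type w) [PartialOrder S] where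
  ambient : Type u
  [addCommGroup : AddCommGroup ambient]
  [module : Module k ambient]
  [finiteDimensional : FiniteDimensional k ambient]
  sub : S → Submodule k ambient
  sub_mono : Monotone sub

attribute [instance] PosetSpace.addCommGroup PosetSpace.module PosetSpace.finiteDimensional

namespace PosetSpace

variable {k : Type u} [Field k]

section basic

variable {S : Type w} [PartialOrder S]

/-- The space of morphisms `U → V`: the linear maps `f` with `f (U(s)) ⊆ V(s)` for all `s`. -/
def homs (U V : PosetSpace k S) : Submodule k (U.ambient →ₗ[k] V.ambient) where
  carrier := {f | ∀ s, U.sub s ≤ (V.sub s).comap f}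
  zero_mem' := fun s _ _ => (V.sub s).zero_mem
  add_mem' := fun hf hg s _ hx => (V.sub s).add_mem (hf s hx) (hg s hx)
  smul_mem' := fun c _ hf s _ hx => (V.sub s).smul_mem c (hf s hx)

instance : Category (PosetSpace k S) where
  Hom U V := homs U V
  id U := ⟨LinearMap.id, fun _ _ hx => hx⟩
  comp f g := ⟨g.1 ∘ₗ f.1, fun s _ hx => g.2 s (f.2 s hx)⟩

/-- The linear map of ambient spaces that gives a morphism. -/
def lin {U V : PosetSpace k S} (f : U ⟶ V) : U.ambient →ₗ[k] V.ambient := f.1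

instance : Preadditive (PosetSpace k S) where
  homGroup U V := inferInstanceAs (AddCommGroup (homs U V))
  add_comp _ _ _ _ _ g := Subtype.ext (LinearMap.comp_add _ _ g.1)
  comp_add _ _ _ f _ _ := Subtype.ext (LinearMap.add_comp f.1 _ _)

/-- `V` is trivial at `t`. -/
def IsTrivialAt (V : PosetSpace k S) (t : S) : Prop := V.sub t = ⊥

/-- The direct sum of two `S`-spaces. -/
def directSum (U V : PosetSpace k S) : PosetSpace k S where
  ambient := U.ambient × V.ambient
  sub s := (U.sub s).prod (V.sub s)
  sub_mono _ _ h := Submodule.prod_mono (U.sub_mono h) (V.sub_mono h)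

/-- `X` is (isomorphic to) a direct summand of `V`. -/
def IsDirectSummand (X V : PosetSpace k S) : Prop :=
  ∃ Y : PosetSpace k S, Nonempty (V ≅ directSum X Y)

/-- The `S`-spaces with no nonzero direct summand trivial at `p`. -/
def noTrivialSummand (k : Type u) [Field k] {S : Type w} [PartialOrder S] (p : S) :
    ObjectProperty (PosetSpace k S) :=
  fun V => ∀ X : PosetSpace k S, IsDirectSummand X V → Nontrivial X.ambient → ¬ X.IsTrivialAt p

/-- `α` factors through `X`. -/
def FactorsThrough {U V : PosetSpace k S} (α : U ⟶ V) (X : PosetSpace k S) : Prop :=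
  ∃ (γ : U ⟶ X) (β : X ⟶ V), α = γ ≫ β

/-- `f` is proper: `f (U(s)) = V(s) ∩ f (U)` for all `s`. -/
def IsProper {U V : PosetSpace k S} (f : U ⟶ V) : Prop :=
  ∀ s, (U.sub s).map (lin f) = V.sub s ⊓ LinearMap.range (lin f)

/-- A proper monomorphism. -/
def IsProperMono {U V : PosetSpace k S} (f : U ⟶ V) : Prop := Mono f ∧ IsProper f

/-- `I` is (relatively) injective. -/
def IsInjective (I : PosetSpace k S) : Prop :=
  ∀ ⦃U V : PosetSpace k S⦄ (f : U ⟶ V) (h : U ⟶ I), IsProperMono f → ∃ e : V ⟶ I, f ≫ e = h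

/-- `f` is an essential monomorphism. -/
def IsEssentialMono {U V : PosetSpace k S} (f : U ⟶ V) : Prop :=
  Mono f ∧ ∀ ⦃X : PosetSpace k S⦄ (h : V ⟶ X), IsProperMono h ↔ IsProperMono (f ≫ h)

/-- `f : V ⟶ I` is an injective envelope of `V`. -/
def IsInjectiveEnvelope {V I : PosetSpace k S} (f : V ⟶ I) : Prop :=
  IsEssentialMono f ∧ IsInjective I

/-- The endofunctor `E^p`: ambient space `V(p)`, subspaces `V(s) ∩ V(p)`. -/
def fullPart (k : Type u) [Field k] {S : Type w} [PartialOrder S] (p : S) :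
    PosetSpace k S ⥤ PosetSpace k S where
  obj V :=
    { ambient := V.sub p
      sub := fun s => (V.sub s).comap (V.sub p).subtype
      sub_mono := fun _ _ h => Submodule.comap_mono (V.sub_mono h) }
  map f := ⟨(lin f).restrict (f.2 p), fun s _ hx => f.2 s hx⟩

/-- The `S`-space `E_p V`: ambient space `V / V(p)`, subspaces `(V(s) + V(p)) / V(p)`. -/
def quotAt (p : S) (V : PosetSpace k S) : PosetSpace k S where
  ambient := V.ambient ⧸ V.sub p
  sub s := (V.sub s).map (V.sub p).mkQ
  sub_mono _ _ h := Submodule.map_mono (V.sub_mono h)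

/-- The projection `π_p(V) : V → E_p V`. -/
def quotProj (p : S) (V : PosetSpace k S) : V ⟶ quotAt p V :=
  ⟨(V.sub p).mkQ, fun _ _ hx => Submodule.mem_map_of_mem hx⟩

end basic

section change

variable {T : Type*} {P : Type*} [PartialOrder T] [PartialOrder P]

/-- Restriction of `P`-spaces to a subposet `T`, where the subposet is given by its inclusion. -/
def res (k : Type u) [Field k] (i : T ↪o P) : PosetSpace k P ⥤ PosetSpace k T where
  obj V :=
    { ambient := V.ambient
      sub := fun t => V.sub (i t)
      sub_mono := fun _ _ h => V.sub_mono (i.monotone h) }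
  map {V W} f := ⟨lin (U := V) (V := W) f, fun t => f.2 (i t)⟩

/-- Induction: the subspace at `s` is the sum of the `V(t)` with `t ∈ T`, `t ≤ s`. -/
def ind (k : Type u) [Field k] (i : T ↪o P) : PosetSpace k T ⥤ PosetSpace k P where
  obj V :=
    { ambient := V.ambient
      sub := fun s => ⨆ (t : T) (_ : i t ≤ s), V.sub t
      sub_mono := fun _ _ h =>
        iSup_mono fun _ => iSup_le fun ht => le_iSup_of_le (ht.trans h) le_rfl }
  map {V W} f := ⟨lin (U := V) (V := W) f, fun _ => iSup₂_le fun t ht =>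
    (f.2 t).trans (Submodule.comap_mono (le_iSup₂_of_le t ht le_rfl))⟩

/-- Coinduction: the subspace at `s` is the intersection of the `V(t)` with `t ∈ T`, `s ≤ t`. -/
def coind (k : Type u) [Field k] (i : T ↪o P) : PosetSpace k T ⥤ PosetSpace k P where
  obj V :=
    { ambient := V.ambient
      sub := fun s => ⨅ (t : T) (_ : s ≤ i t), V.sub t
      sub_mono := fun _ _ h =>
        iInf_mono fun _ => le_iInf fun ht => iInf_le_of_le (h.trans ht) le_rfl }
  map {V W} f := ⟨lin (U := V) (V := W) f, fun s x hx => by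
    change lin (U := V) (V := W) f x ∈ ⨅ (t : T) (_ : s ≤ i t), W.sub t
    simp only [Submodule.mem_iInf] at hx ⊢
    exact fun t ht => f.2 t (hx t ht)⟩

end change

section extension

variable {P : Type w} [PartialOrder P] {T : Set P}

/-- The linear map `U → V` of ambient spaces that gives a morphism from the restriction of the
`P`-space `U` to the `T`-space `V`. -/
def resLin {U : PosetSpace k P} {V : PosetSpace k T} (g : (res k (subposet T)).obj U ⟶ V) :
    U.ambient →ₗ[k] V.ambient := lin g

open Classical in
/-- For a filter `T` of `P`, a `P`-space `U`, a `T`-space `V` and a morphism `g` from the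
restriction of `U` to `V`, this is the `P`-space `V^g` with the ambient space of `V`, the
subspace `V(t)` at `t ∈ T`, and the subspace `g (U(t))` at `t ∉ T`. -/
noncomputable def extend (hT : IsUpperSet T) {U : PosetSpace k P} {V : PosetSpace k T}
    (g : (res k (subposet T)).obj U ⟶ V) : PosetSpace k P where
  ambient := V.ambient
  sub t := if h : t ∈ T then V.sub ⟨t, h⟩ else (U.sub t).map (resLin g)
  sub_mono := by
    intro s t hst
    by_cases hs : s ∈ T
    · have ht : t ∈ T := hT hst hs
      simp only [hs, ht, dif_pos]
      exact V.sub_mono hst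
    · by_cases ht : t ∈ T
      · simp only [hs, ht, dif_pos, dif_neg, not_false_eq_true]
        exact (Submodule.map_mono (U.sub_mono hst)).trans
          (Submodule.map_le_iff_le_comap.mpr (g.2 ⟨t, ht⟩))
      · simp only [hs, ht, dif_neg, not_false_eq_true]
        exact Submodule.map_mono (U.sub_mono hst)

/-- The morphism `U → V^g` given by the linear map `g`. -/
noncomputable def extendHom (hT : IsUpperSet T) {U : PosetSpace k P} {V : PosetSpace k T}
    (g : (res k (subposet T)).obj U ⟶ V) : U ⟶ extend hT g :=
  ⟨resLin g, by
    intro t x hx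
    have h : resLin g x ∈ (extend hT g).sub t := by
      by_cases ht : t ∈ T
      · simp only [extend, ht, dif_pos]
        exact g.2 ⟨t, ht⟩ hx
      · simp only [extend, ht, dif_neg, not_false_eq_true]
        exact Submodule.mem_map_of_mem hx
    exact h⟩

end extension

/-- The functor `res_J E^p ind` from `S`-spaces to `J`-spaces, where `J ⊆ S^R` and `p ∈ S`. -/
def idealFunctor (k : Type u) [Field k] {S : Type w} [PartialOrder S] (R : Set S)
    (J : Set (UpperExt R)) (p : S) : PosetSpace k S ⥤ PosetSpace k J :=
  ind k (UpperExt.incl R) ⋙ fullPart k (UpperExt.incl R p) ⋙ res k (subposet J)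

end PosetSpace

open PosetSpace

/-! Since `J` is down-closed and `p ∉ J`, no element of `J` lies above `p`, so coinduction puts the
whole of `W` at `p`. As `p ∈ R`, this makes the subspace of `I^g` at `p` equal to the image of `g`.
The kernel-cokernel statement follows, and so does the recovery of `W`: `E^p` cuts out `g(W)`,
properness carries the subspaces back, and coinduction leaves those at `J` unchanged.

That `I^g` is induced from `S` means that its subspace at an antichain `A` is the sum of those at
the elements of `A`. Since `A` is the join of its elements, injectivity of `I` forces this
(`IsInjective.sub_le_iSup`). Induction changes nothing at `S`, so restriction recovers `V`.

The functor kills `α` exactly when `α` vanishes on `U(p)`, that is, when `α` factors through `U /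
U(p)`.

For (d), Fitting's lemma shows that there is no nonzero summand trivial at `p` exactly when every
endomorphism fixing `V(p)` pointwise is injective (`noTrivialSummand_iff`). For `I^g` these are the
endomorphisms fixing the image of `g`, and their injectivity amounts to essentiality of `g`
(`isInjectiveEnvelope_iff`). Density follows by embedding into an injective space and discarding the
trivial summands. -/

namespace PosetSpace

/-! ### Morphisms, proper monomorphisms and linear algebra -/

section general

variable {k : Type u} [Field k] {S : Type*} [PartialOrder S] {U V X : PosetSpace k S}

/-- The morphism given by a linear map that respects the subspaces. -/
def homMk (f : U.ambient →ₗ[k] V.ambient) (hf : ∀ s, ∀ x ∈ U.sub s, f x ∈ V.sub s) : U ⟶ V :=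
  ⟨f, hf⟩

@[simp]
theorem lin_comp (f : U ⟶ V) (g : V ⟶ X) : lin (f ≫ g) = lin g ∘ₗ lin f := rfl

theorem lin_mem (f : U ⟶ V) {s : S} {x : U.ambient} (hx : x ∈ U.sub s) : lin f x ∈ V.sub s :=
  f.2 s hx

theorem hom_ext_lin {f g : U ⟶ V} (h : ∀ x, lin f x = lin g x) : f = g :=
  Subtype.ext (LinearMap.ext h)

theorem lin_hom_inv (e : U ≅ V) (x : U.ambient) : lin e.inv (lin e.hom x) = x :=
  congrArg (fun f : U ⟶ U => lin f x) e.hom_inv_id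

theorem lin_inv_hom (e : U ≅ V) (x : V.ambient) : lin e.hom (lin e.inv x) = x :=
  congrArg (fun f : V ⟶ V => lin f x) e.inv_hom_id

theorem mono_iff_injective (f : U ⟶ V) : Mono f ↔ Function.Injective (lin f) := by
  constructor
  · intro hf
    rw [← LinearMap.ker_eq_bot, Submodule.eq_bot_iff]
    intro x hx
    -- With zero subspaces, every linear map out of the kernel is a morphism.
    let K : PosetSpace k S :=
      { ambient := LinearMap.ker (lin f)
        sub := fun _ => ⊥
        sub_mono := fun _ _ _ => le_rfl }
    let i : K ⟶ U := homMk (LinearMap.ker (lin f)).subtype (fun s x hx => by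
      rw [(Submodule.mem_bot k).1 hx]
      simp)
    have h : i = 0 := (cancel_mono f).1 (hom_ext_lin fun y =>
      (LinearMap.mem_ker.1 y.2).trans (map_zero (lin f)).symm)
    exact congrArg (fun j : K ⟶ U => lin j ⟨x, hx⟩) h
  · intro hf
    exact ⟨fun a b hab => hom_ext_lin fun x =>
      hf (congrArg (fun j => lin j x) hab)⟩

theorem isProperMono_iff (f : U ⟶ V) : IsProperMono f ↔
    Function.Injective (lin f) ∧ ∀ s x, lin f x ∈ V.sub s → x ∈ U.sub s := by
  rw [IsProperMono, mono_iff_injective]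
  refine and_congr_right fun hf => forall_congr' fun s => ?_
  constructor
  · intro h x hx
    have hx' : lin f x ∈ (U.sub s).map (lin f) := by
      rw [h]
      exact ⟨hx, x, rfl⟩
    obtain ⟨y, hy, hyx⟩ := hx'
    rwa [← hf hyx]
  · intro h
    ext y
    constructor
    · rintro ⟨x, hx, rfl⟩
      exact ⟨lin_mem f hx, x, rfl⟩
    · rintro ⟨hy, x, rfl⟩
      exact ⟨x, h x hy, rfl⟩

theorem isProperMono_comp {f : U ⟶ V} {h : V ⟶ X} (hf : IsProperMono f) (hh : IsProperMono h) :
    IsProperMono (f ≫ h) := by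
  rw [isProperMono_iff] at *
  exact ⟨hh.1.comp hf.1, fun s x hx => hf.2 s x (hh.2 s _ hx)⟩

/-- A linear equivalence that identifies the subspaces gives an isomorphism. -/
def isoMk (e : U.ambient ≃ₗ[k] V.ambient) (he : ∀ s x, x ∈ U.sub s ↔ e x ∈ V.sub s) : U ≅ V where
  hom := homMk e.toLinearMap fun s x hx => (he s x).1 hx
  inv := homMk e.symm.toLinearMap fun s x hx => (he s _).2 (by simpa using hx)
  hom_inv_id := hom_ext_lin fun x => e.symm_apply_apply x
  inv_hom_id := hom_ext_lin fun x => e.apply_symm_apply x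

theorem exists_lift_of_isProperMono {f : U ⟶ V} (hf : IsProperMono f) (h : X ⟶ V)
    (hr : LinearMap.range (lin h) ≤ LinearMap.range (lin f)) : ∃ l : X ⟶ U, l ≫ f = h := by
  rw [isProperMono_iff] at hf
  let e := LinearEquiv.ofInjective (lin f) hf.1
  let c : X.ambient →ₗ[k] LinearMap.range (lin f) :=
    (lin h).codRestrict _ fun x => hr ⟨x, rfl⟩
  have key : ∀ x, lin f (e.symm (c x)) = lin h x := fun x =>
    congrArg Subtype.val (e.apply_symm_apply (c x))
  exact ⟨homMk (e.symm.toLinearMap ∘ₗ c) fun s x hx => hf.2 s _ (by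
    change lin f (e.symm (c x)) ∈ _
    rw [key]
    exact lin_mem h hx), hom_ext_lin key⟩

/-- By finite dimension, an injective `f` maps an invariant `N` onto itself. This is how properness
is obtained from mere injectivity. -/
theorem mem_of_injective_of_invariant {M : Type*} [AddCommGroup M] [Module k M]
    [FiniteDimensional k M] {f : M →ₗ[k] M} (hf : Function.Injective f) {N : Submodule k M}
    (hN : ∀ x ∈ N, f x ∈ N) {y : M} (hy : f y ∈ N) : y ∈ N := by
  have hi : Function.Injective (f.restrict hN) := fun a b hab =>
    Subtype.ext (hf (congrArg Subtype.val hab))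
  obtain ⟨z, hz⟩ := LinearMap.surjective_of_injective hi ⟨f y, hy⟩
  rw [← hf (congrArg Subtype.val hz)]
  exact z.2

/-- The condition `hf` makes the induced map `A / A' → B / B'` injective, hence split; the extension
is `h` on `A / A'` composed with the splitting. -/
theorem exists_extend_of_le_ker {A B M : Type*} [AddCommGroup A] [AddCommGroup B]
    [AddCommGroup M] [Module k A] [Module k B] [Module k M] {f : A →ₗ[k] B}
    {A' : Submodule k A} {B' : Submodule k B} (hf : ∀ x, f x ∈ B' ↔ x ∈ A')
    {h : A →ₗ[k] M} (hh : A' ≤ LinearMap.ker h) :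
    ∃ e : B →ₗ[k] M, (∀ x, e (f x) = h x) ∧ B' ≤ LinearMap.ker e := by
  have hle : A' ≤ B'.comap f := fun x hx => (hf x).2 hx
  obtain ⟨r, hr⟩ := (A'.mapQ B' f hle).exists_leftInverse_of_injective (by
    rw [Submodule.eq_bot_iff]
    intro x hx
    obtain ⟨a, rfl⟩ := A'.mkQ_surjective x
    have : f a ∈ B' := (Submodule.Quotient.mk_eq_zero B').1 hx
    exact (Submodule.Quotient.mk_eq_zero A').2 ((hf a).1 this))
  refine ⟨A'.liftQ h hh ∘ₗ r ∘ₗ B'.mkQ, fun x => ?_, fun b hb => ?_⟩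
  · have := congrArg (A'.liftQ h hh) (LinearMap.congr_fun hr (A'.mkQ x))
    simpa using this
  · simp [(Submodule.Quotient.mk_eq_zero B').2 hb]

/-! ### Injective spaces -/

/-- Here `A` is the join of the `a i`. A vector `x ∈ I(A)` is a morphism from a one-dimensional
space `B`, and `B` embeds diagonally and properly into a space `C` whose `i`-th basis vector lies in
`C(a i)`. Extending to `C` writes `x` as a sum of vectors of the `I(a i)`. -/
theorem IsInjective.sub_le_iSup {I : PosetSpace k S} (hI : IsInjective I) {ι : Type*} [Finite ι]
    [Nonempty ι] {A : S} {a : ι → S} (ha : ∀ s, A ≤ s ↔ ∀ i, a i ≤ s) :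
    I.sub A ≤ ⨆ i, I.sub (a i) := by
  classical
  intro x hx
  -- Indexing by `Fin n` keeps the ambient space of `C` in the universe of `k`.
  obtain ⟨n, ⟨c⟩⟩ := Finite.exists_equiv_fin ι
  let B : PosetSpace k S :=
    { ambient := k
      sub := fun s => ⨆ _ : A ≤ s, ⊤
      sub_mono := fun s t hst => iSup_le fun h => le_iSup_of_le (h.trans hst) le_rfl }
  -- `C(s)` consists of the vectors supported on the indices whose `a i` lies below `s`.
  let C : PosetSpace k S :=
    { ambient := Fin n → k
      sub := fun s => ⨅ (i : Fin n) (_ : ¬ a (c.symm i) ≤ s), LinearMap.ker (LinearMap.proj i)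
      sub_mono := fun s t hst => iInf_mono fun i => le_iInf fun h =>
        iInf_le_of_le (fun h' => h (h'.trans hst)) le_rfl }
  have hB : ∀ s, (y : k) → y ∈ B.sub s → y = 0 ∨ A ≤ s := by
    intro s y hy
    by_cases h : A ≤ s
    · exact Or.inr h
    · left
      change y ∈ (⨆ _ : A ≤ s, ⊤ : Submodule k k) at hy
      rw [iSup_neg h] at hy
      exact (Submodule.mem_bot k).1 hy
  have hC : ∀ s, (y : Fin n → k) → (y ∈ C.sub s ↔ ∀ i, ¬ a (c.symm i) ≤ s → y i = 0) := by
    intro s y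
    simp only [C, Submodule.mem_iInf, LinearMap.mem_ker, LinearMap.proj_apply]
  let f : B ⟶ C := homMk (LinearMap.pi fun _ => LinearMap.id) (fun s y hy => by
    rw [hC]
    intro i hi
    rcases hB s y hy with h | h
    · exact h
    · exact absurd ((ha s).1 h _) hi)
  let h : B ⟶ I := homMk (LinearMap.toSpanSingleton k _ x) (fun s y hy => by
    rcases hB s y hy with h | h
    · simp [h]
    · exact (I.sub s).smul_mem _ (I.sub_mono h hx))
  have hf : IsProperMono f := by
    rw [isProperMono_iff]
    refine ⟨fun y z hyz => congrFun hyz (c (Classical.arbitrary ι)), fun s y hy => ?_⟩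
    have hy' := (hC s _).1 hy
    -- If `A ≤ s` fails, some `a i ≤ s` fails too, and that coordinate of the diagonal vector must
    -- vanish.
    by_cases hA : A ≤ s
    · simp [B, hA]
    · rw [ha] at hA
      push Not at hA
      obtain ⟨i, hi⟩ := hA
      have h0 : y = 0 := hy' (c i) (by simpa using hi)
      rw [h0]
      exact Submodule.zero_mem _
  obtain ⟨e, he⟩ := hI f h hf
  have hx' : x = lin e (fun _ => 1) := by
    have := congrArg (fun j : B ⟶ I => lin j (1 : k)) he
    have h1 : lin h (1 : k) = x := one_smul k x
    exact h1.symm.trans this.symm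
  have hsum : (fun _ => 1 : Fin n → k) = ∑ i, Pi.single i (1 : k) :=
    (Finset.univ_sum_single _).symm
  have hmap : x = ∑ i, lin e (Pi.single i (1 : k) : Fin n → k) := by
    rw [hx', hsum]
    exact map_sum (lin e) _ _
  rw [hmap]
  refine Submodule.sum_mem _ fun i _ => ?_
  refine Submodule.mem_iSup_of_mem (c.symm i) (lin_mem e ?_)
  rw [hC]
  intro j hj
  have : j ≠ i := by
    rintro rfl
    exact hj le_rfl
  simp [this]

/-- The embedding is `x ↦ (x, (x mod U(t))_t)`: the first factor gives injectivity, the coordinate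
at `s` gives properness at `s`. A morphism from `A` into `I` is a linear map from `A` to `U`
together with independent linear maps killing `A(t)` into the `U / U(t)`, and each of these extends
along a proper monomorphism. -/
theorem exists_isProperMono_isInjective [Finite S] (U : PosetSpace k S) :
    ∃ (I : PosetSpace k S) (g : U ⟶ I), IsProperMono g ∧ IsInjective I := by
  obtain ⟨n, ⟨c⟩⟩ := Finite.exists_equiv_fin S
  let I : PosetSpace k S :=
    { ambient := U.ambient × (∀ i : Fin n, U.ambient ⧸ U.sub (c.symm i))
      sub := fun s => ⨅ (i : Fin n) (_ : s ≤ c.symm i),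
        LinearMap.ker (LinearMap.proj i ∘ₗ LinearMap.snd k _ _)
      sub_mono := fun s t hst => iInf_mono fun i => le_iInf fun h =>
        iInf_le_of_le (hst.trans h) le_rfl }
  have hI : ∀ s, (y : U.ambient × (∀ i : Fin n, U.ambient ⧸ U.sub (c.symm i))) →
      (y ∈ I.sub s ↔ ∀ i, s ≤ c.symm i → y.2 i = 0) := by
    intro s y
    simp only [I, Submodule.mem_iInf, LinearMap.mem_ker, LinearMap.comp_apply,
      LinearMap.proj_apply, LinearMap.snd_apply]
  let g : U ⟶ I := homMk (LinearMap.prod LinearMap.id (LinearMap.pi fun i => (U.sub _).mkQ))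
    (fun s x hx => (hI s _).2 fun i hi =>
      (Submodule.Quotient.mk_eq_zero _).2 (U.sub_mono hi hx))
  refine ⟨I, g, (isProperMono_iff g).2 ⟨fun x y hxy => congrArg Prod.fst hxy, fun s x hx => ?_⟩,
    fun A B f h hf => ?_⟩
  · have := (hI s _).1 hx (c s) (by simp)
    simpa using (Submodule.Quotient.mk_eq_zero _).1 this
  · rw [isProperMono_iff] at hf
    let h' : A.ambient →ₗ[k] U.ambient × (∀ i : Fin n, U.ambient ⧸ U.sub (c.symm i)) := lin h
    obtain ⟨e₀, he₀, -⟩ := exists_extend_of_le_ker (f := lin f) (A' := ⊥) (B' := ⊥)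
      (h := LinearMap.fst k _ _ ∘ₗ h') (fun x => by
        rw [Submodule.mem_bot, Submodule.mem_bot, map_eq_zero_iff _ hf.1]) bot_le
    have hex : ∀ i : Fin n, ∃ e : B.ambient →ₗ[k] U.ambient ⧸ U.sub (c.symm i),
        (∀ x, e (lin f x) = (h' x).2 i) ∧ B.sub (c.symm i) ≤ LinearMap.ker e := fun i =>
      exists_extend_of_le_ker (f := lin f) (A' := A.sub (c.symm i)) (B' := B.sub (c.symm i))
        (h := LinearMap.proj i ∘ₗ LinearMap.snd k _ _ ∘ₗ h')
        (fun x => ⟨hf.2 _ x, fun hx => lin_mem f hx⟩)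
        (fun x hx => LinearMap.mem_ker.2 ((hI _ _).1 (lin_mem h hx) i le_rfl))
    choose e he he' using hex
    refine ⟨homMk (LinearMap.prod e₀ (LinearMap.pi e)) fun s x hx => (hI s _).2 fun i hi =>
      he' i (B.sub_mono hi hx), hom_ext_lin fun x => ?_⟩
    exact Prod.ext (he₀ x) (funext fun i => he i x)

/-! ### Summands trivial at `p`, and factorization through spaces trivial at `p` -/

/-- A non-injective `θ` fixing `V(p)` yields, by Fitting's lemma, the summand `ker θ^n`, which meets
`V(p)` in zero. Conversely, the projection that kills a summand trivial at `p` fixes `V(p)`. -/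
theorem noTrivialSummand_iff (p : S) (V : PosetSpace k S) :
    noTrivialSummand k p V ↔
      ∀ θ : V ⟶ V, (∀ x ∈ V.sub p, lin θ x = x) → Function.Injective (lin θ) := by
  constructor
  · intro hV θ hθ
    -- The bound `1 ≤ n` ensures that the kernel of `θ` is contained in that of `θ ^ n`.
    obtain ⟨n, hn, hc⟩ := ((Filter.eventually_ge_atTop 1).and
      (lin θ).eventually_isCompl_ker_pow_range_pow).exists
    let f := lin θ ^ n
    have hf : ∀ s, ∀ x ∈ V.sub s, f x ∈ V.sub s := fun s x hx =>
      Module.End.pow_apply_mem_of_forall_mem n (fun y hy => lin_mem θ hy) x hx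
    have hfp : ∀ x ∈ V.sub p, f x = x := by
      intro x hx
      have := (Function.IsFixedPt.iterate (hθ x hx : Function.IsFixedPt (lin θ) x) n)
      rw [Module.End.pow_apply]
      exact this
    let K : PosetSpace k S :=
      { ambient := LinearMap.ker f
        sub := fun s => (V.sub s).comap (LinearMap.ker f).subtype
        sub_mono := fun _ _ h => Submodule.comap_mono (V.sub_mono h) }
    let N : PosetSpace k S :=
      { ambient := LinearMap.range f
        sub := fun s => (V.sub s).comap (LinearMap.range f).subtype
        sub_mono := fun _ _ h => Submodule.comap_mono (V.sub_mono h) }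
    have hinj : Function.Injective (f.restrict (p := LinearMap.range f) (q := LinearMap.range f)
        fun x _ => ⟨x, rfl⟩) := by
      rw [← LinearMap.ker_eq_bot, Submodule.eq_bot_iff]
      rintro ⟨x, hx⟩ h0
      exact Subtype.ext ((Submodule.disjoint_def.1 hc.disjoint) x (congrArg Subtype.val h0) hx)
    let e : (directSum K N).ambient ≃ₗ[k] V.ambient := Submodule.prodEquivOfIsCompl _ _ hc
    have hKN : directSum K N ≅ V := isoMk e (by
      rintro s ⟨m, y⟩
      change (m : V.ambient) ∈ V.sub s ∧ (y : V.ambient) ∈ V.sub s ↔ (m + y : V.ambient) ∈ V.sub s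
      refine ⟨fun h => add_mem h.1 h.2, fun h => ?_⟩
      -- The Fitting decomposition respects each `V(s)`: `f` kills `m`, so `f y ∈ V(s)`, and `f` is
      -- injective on its range.
      have hy : (y : V.ambient) ∈ V.sub s := by
        have h1 : f y ∈ V.sub s := by
          have := hf s _ h
          rwa [map_add, LinearMap.mem_ker.1 m.2, zero_add] at this
        exact mem_of_injective_of_invariant hinj
          (N := (V.sub s).comap (LinearMap.range f).subtype) (fun x hx => hf s x hx) h1
      exact ⟨(Submodule.add_mem_iff_left _ hy).1 h, hy⟩)
    by_contra hni
    refine hV K ⟨N, ⟨hKN.symm⟩⟩ ?_ ?_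
    · change Nontrivial (LinearMap.ker f)
      rw [Submodule.nontrivial_iff_ne_bot]
      intro hbot
      refine hni (LinearMap.ker_eq_bot.1 (le_bot_iff.1 (le_trans ?_ hbot.le)))
      obtain ⟨m, rfl⟩ := Nat.exists_eq_add_of_le hn
      intro x hx
      change (lin θ ^ (1 + m)) x = 0
      rw [add_comm, pow_succ, Module.End.mul_apply, LinearMap.mem_ker.1 hx, map_zero]
    · change (V.sub p).comap (LinearMap.ker f).subtype = ⊥
      rw [Submodule.eq_bot_iff]
      rintro ⟨x, hx⟩ hxp
      exact Subtype.ext ((hfp x hxp).symm.trans hx)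
  · rintro hV X ⟨Y, ⟨e⟩⟩ hX hXp
    let q : directSum X Y ⟶ directSum X Y :=
      homMk (LinearMap.prodMap 0 LinearMap.id) (fun s x hx => ⟨zero_mem _, hx.2⟩)
    have hinj := hV (e.hom ≫ q ≫ e.inv) (fun x hx => by
      have h1 : (lin e.hom x).1 = 0 := by
        have := (lin_mem e.hom hx).1
        rwa [hXp] at this
      have h2 : lin q (lin e.hom x) = lin e.hom x := Prod.ext h1.symm rfl
      change lin e.inv (lin q (lin e.hom x)) = x
      rw [h2, lin_hom_inv])
    obtain ⟨x, hx⟩ := exists_ne (0 : X.ambient)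
    let z : (directSum X Y).ambient := (x, 0)
    have hz : lin (e.hom ≫ q ≫ e.inv) (lin e.inv z) = 0 := by
      change lin e.inv (lin q (lin e.hom (lin e.inv z))) = 0
      rw [lin_inv_hom]
      have : lin q z = 0 := Prod.ext rfl rfl
      rw [this, map_zero]
    have hz' : lin e.inv z = 0 := hinj (hz.trans (map_zero _).symm)
    have : z = 0 := by rw [← lin_inv_hom e z, hz', map_zero]
    exact hx (congrArg Prod.fst this)

theorem noTrivialSummand_of_iso {p : S} (e : U ≅ V) (h : noTrivialSummand k p U) :
    noTrivialSummand k p V :=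
  fun X ⟨Y, ⟨i⟩⟩ => h X ⟨Y, ⟨e ≪≫ i⟩⟩

/-- The space `U / U(p)` is the universal choice of `X`. -/
theorem factorsThrough_trivial_iff (p : S) (α : U ⟶ V) :
    (∃ X : PosetSpace k S, X.IsTrivialAt p ∧ FactorsThrough α X) ↔
      ∀ x ∈ U.sub p, lin α x = 0 := by
  constructor
  · rintro ⟨X, hX, γ, β, rfl⟩ x hx
    have : lin γ x = 0 := by
      have := lin_mem γ hx
      rwa [hX] at this
    rw [lin_comp, LinearMap.comp_apply, this, map_zero]
  · intro h
    refine ⟨quotAt p U, ?_, quotProj p U, homMk ((U.sub p).liftQ (lin α) h) ?_,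
      hom_ext_lin fun x => rfl⟩
    · exact (Submodule.mkQ_map_self _)
    · rintro s _ ⟨x, hx, rfl⟩
      exact lin_mem α hx

/-! ### The projection `π_p` as a cokernel, and its kernel -/

theorem exists_isColimit_quotProj {f : U ⟶ V} {p : S} (hp : V.sub p = LinearMap.range (lin f)) :
    ∃ h : f ≫ quotProj p V = 0, Nonempty (IsColimit (CokernelCofork.ofπ (quotProj p V) h)) := by
  refine ⟨hom_ext_lin fun x => (Submodule.Quotient.mk_eq_zero _).2 (hp ▸ ⟨x, rfl⟩), ⟨?_⟩⟩
  refine CokernelCofork.IsColimit.ofπ _ _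
    (fun g hg => homMk ((V.sub p).liftQ (lin g) ?_) ?_) (fun g hg => rfl) ?_
  · rw [hp]
    rintro _ ⟨x, rfl⟩
    exact congrArg (fun j => lin j x) hg
  · rintro s _ ⟨x, hx, rfl⟩
    exact lin_mem g hx
  · intro Z g hg m hm
    refine hom_ext_lin fun x => ?_
    obtain ⟨y, rfl⟩ := (V.sub p).mkQ_surjective x
    exact congrArg (fun j => lin j y) hm

theorem nonempty_isLimit_kernelFork {f : U ⟶ V} (hf : IsProperMono f) {p : S}
    (hp : V.sub p = LinearMap.range (lin f)) (h : f ≫ quotProj p V = 0) :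
    Nonempty (IsLimit (KernelFork.ofι f h)) := by
  have := hf.1
  have key : ∀ {Z : PosetSpace k S} (g : Z ⟶ V), g ≫ quotProj p V = 0 → ∃ l : Z ⟶ U, l ≫ f = g := by
    intro Z g hg
    refine exists_lift_of_isProperMono hf g ?_
    rw [← hp]
    rintro _ ⟨x, rfl⟩
    exact (Submodule.Quotient.mk_eq_zero _).1 (congrArg (fun j => lin j x) hg)
  exact ⟨KernelFork.IsLimit.ofι' f h fun g hg => ⟨(key g hg).choose, (key g hg).choose_spec⟩⟩

/-- This serves `res_extend`, where the restriction of `I^g` is to equal `I` as an object: transport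
along an equality of subspace families is the identity on vectors. -/
theorem lin_eqToHom_mk {I : PosetSpace k S} {a : S → Submodule k I.ambient} (ha : Monotone a)
    (h : a = I.sub) : ∃ h : PosetSpace.mk I.ambient a ha = I,
      ∀ x : I.ambient, lin (eqToHom h) x = x := by
  subst h
  exact ⟨rfl, fun x => rfl⟩

/-- The projection of a direct sum onto its second summand. -/
def sndHom (X Y : PosetSpace k S) : directSum X Y ⟶ Y :=
  homMk (U := directSum X Y) (LinearMap.snd k X.ambient Y.ambient) fun _ _ hx => hx.2

/-- The inclusion of the second summand into a direct sum. -/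
def inrHom (X Y : PosetSpace k S) : Y ⟶ directSum X Y :=
  homMk (V := directSum X Y) (LinearMap.inr k X.ambient Y.ambient) fun s _ hx =>
    ⟨(X.sub s).zero_mem, hx⟩

end general

/-! ### Induction and coinduction -/

section change

variable {k : Type u} [Field k] {T P : Type*} [PartialOrder T] [PartialOrder P] (i : T ↪o P)

theorem ind_obj_sub (V : PosetSpace k T) (t : T) : ((ind k i).obj V).sub (i t) = V.sub t :=
  le_antisymm (iSup₂_le fun _ hs => V.sub_mono (i.le_iff_le.1 hs))
    (le_iSup₂_of_le (f := fun s (_ : i s ≤ i t) => V.sub s) t le_rfl le_rfl)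

/-- Restriction after induction is the identity. -/
def resIndIso (V : PosetSpace k T) : (res k i).obj ((ind k i).obj V) ≅ V :=
  isoMk (LinearEquiv.refl k V.ambient) fun t _ => by
    have h := ind_obj_sub i V t
    change _ ∈ ((ind k i).obj V).sub (i t) ↔ _
    rw [h]
    rfl

/-- A space that is generated by its restriction to `T` is induced from it. -/
def isoIndRes (V : PosetSpace k P) (hV : ∀ A, V.sub A ≤ ⨆ (t : T) (_ : i t ≤ A), V.sub (i t)) :
    V ≅ (ind k i).obj ((res k i).obj V) :=
  isoMk (LinearEquiv.refl k V.ambient) fun A _ =>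
    ⟨fun hx => hV A hx, fun hx => (iSup₂_le fun _ ht => V.sub_mono ht :
      (⨆ (t : T) (_ : i t ≤ A), V.sub (i t)) ≤ V.sub A) hx⟩

theorem coind_obj_sub_of_mem {J : Set P} (W : PosetSpace k J) (j : J) :
    ((coind k (subposet J)).obj W).sub j = W.sub j :=
  le_antisymm (iInf₂_le_of_le (f := fun s (_ : (j : P) ≤ subposet J s) => W.sub s) j le_rfl le_rfl)
    (le_iInf₂ fun _ hs => W.sub_mono hs)

/-- Nothing in a down-closed `J` lies above `s ∉ J`, so the intersection is empty. -/
theorem coind_obj_sub_of_notMem {J : Set P} (hJ : IsLowerSet J) (W : PosetSpace k J) {s : P}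
    (hs : s ∉ J) : ((coind k (subposet J)).obj W).sub s = ⊤ :=
  le_antisymm le_top (le_iInf₂ fun t ht => absurd (hJ ht t.2) hs)

end change

/-! ### The space `I^g` and injective envelopes -/

section extension

variable {k : Type u} [Field k] {P : Type w} [PartialOrder P] {T : Set P} (hT : IsUpperSet T)
  {U : PosetSpace k P} {I : PosetSpace k T} (g : (res k (subposet T)).obj U ⟶ I)

theorem extend_sub_of_mem {t : P} (ht : t ∈ T) : (extend hT g).sub t = I.sub ⟨t, ht⟩ :=
  dif_pos ht

theorem extend_sub_of_notMem {t : P} (ht : t ∉ T) :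
    (extend hT g).sub t = (U.sub t).map (resLin g) :=
  dif_neg ht

theorem isProperMono_extendHom (hg : IsProperMono g) : IsProperMono (extendHom hT g) := by
  have hg' := (isProperMono_iff g).1 hg
  rw [isProperMono_iff]
  refine ⟨hg'.1, fun s x hx => ?_⟩
  by_cases hs : s ∈ T
  · rw [extend_sub_of_mem hT g hs] at hx
    exact hg'.2 ⟨s, hs⟩ x hx
  · rw [extend_sub_of_notMem hT g hs] at hx
    obtain ⟨y, hy, hyx⟩ := hx
    have : y = x := hg'.1 hyx
    exact this ▸ hy

theorem res_extend : ∃ h : (res k (subposet T)).obj (extend hT g) = I,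
    (res k (subposet T)).map (extendHom hT g) ≫ eqToHom h = g := by
  obtain ⟨h, hh⟩ := lin_eqToHom_mk (I := I) (a := fun t : T => (extend hT g).sub t)
    (fun _ _ hst => (extend hT g).sub_mono hst)
    (funext fun t => extend_sub_of_mem hT g t.2)
  exact ⟨h, hom_ext_lin fun x => hh _⟩

/-- The restriction of an endomorphism of `I^g`. -/
noncomputable def extendRestrict (θ : extend hT g ⟶ extend hT g) : I ⟶ I :=
  homMk (U := I) (V := I) (lin (U := extend hT g) (V := extend hT g) θ) fun t x hx => by
    have h := extend_sub_of_mem hT g t.2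
    have h' : x ∈ (extend hT g).sub t := h ▸ hx
    exact h ▸ lin_mem θ h'

/-- Both sides concern endomorphisms fixing the image of `g`. If `g` is essential, such a `θ`
satisfies `g ≫ θ = g`, so it is a proper monomorphism. Conversely, if `g ≫ h` is a proper
monomorphism, injectivity of `I` gives `e` with `g ≫ h ≫ e = g`; then `h ≫ e` is injective, which
makes `h` a proper monomorphism. -/
theorem isInjectiveEnvelope_iff (hg : IsProperMono g) (hI : IsInjective I) {p : P}
    (hp : (extend hT g).sub p = LinearMap.range (resLin g)) :
    IsInjectiveEnvelope g ↔ noTrivialSummand k p (extend hT g) := by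
  rw [noTrivialSummand_iff]
  constructor
  · rintro ⟨⟨-, hess⟩, -⟩ θ hθ
    have h : g ≫ extendRestrict hT g θ = g := hom_ext_lin fun x =>
      hθ (resLin g x) (by
        rw [hp]
        exact ⟨x, rfl⟩)
    exact ((isProperMono_iff _).1 ((hess (extendRestrict hT g θ)).2 (h.symm ▸ hg))).1
  · refine fun H => ⟨⟨hg.1, fun X h => ⟨isProperMono_comp hg, fun hgh => ?_⟩⟩, hI⟩
    obtain ⟨e, he⟩ := hI (g ≫ h) g hgh
    have hfix : ∀ x, lin e (lin h (resLin g x)) = resLin g x := fun x =>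
      congrArg (fun j : (res k (subposet T)).obj U ⟶ I => lin j x) he
    -- Outside `T` the subspaces of `I^g` lie in the image of `g`, which `h ≫ e` fixes; hence it is
    -- an endomorphism of `I^g`, not only of `I`.
    let θ : extend hT g ⟶ extend hT g :=
      homMk (U := extend hT g) (V := extend hT g) (lin (U := I) (V := I) (h ≫ e)) fun s x hx => by
        by_cases hs : s ∈ T
        · rw [extend_sub_of_mem hT g hs] at hx ⊢
          exact lin_mem (h ≫ e) hx
        · rw [extend_sub_of_notMem hT g hs] at hx ⊢
          obtain ⟨y, hy, rfl⟩ := hx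
          exact ⟨y, hy, (hfix y).symm⟩
    have hinj : Function.Injective (lin (h ≫ e)) := H θ fun x hx => by
      rw [hp] at hx
      obtain ⟨y, rfl⟩ := hx
      exact hfix y
    refine (isProperMono_iff h).2 ⟨Function.Injective.of_comp hinj, fun s x hx => ?_⟩
    exact mem_of_injective_of_invariant hinj (fun y hy => lin_mem (h ≫ e) hy)
      (lin_mem e hx : lin (h ≫ e) x ∈ I.sub s)

end extension

/-! ### The poset `S^R` and the functor to `J`-spaces -/

section upperExt

variable {k : Type u} [Field k] {S : Type w} [PartialOrder S] {R : Set S}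

instance [Finite S] : Finite (CheckAntichain S) :=
  Finite.of_injective CheckAntichain.carrier fun _ _ => CheckAntichain.ext

theorem incl_le_iff {s : S} {A : UpperExt R} :
    UpperExt.incl R s ≤ A ↔ ∃ b ∈ A.1.carrier, s ≤ b :=
  ⟨fun h => h s rfl, fun h a ha => by
    have : a = s := ha
    rwa [this]⟩

/-- Thus `A` is the join of its elements in `S^R`, as `IsInjective.sub_le_iSup` requires. -/
theorem le_iff_incl_le {A B : UpperExt R} :
    A ≤ B ↔ ∀ a : A.1.carrier, UpperExt.incl R a ≤ B :=
  ⟨fun h a => incl_le_iff.2 (h a a.2), fun h a ha => incl_le_iff.1 (h ⟨a, ha⟩)⟩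

theorem incl_notMem_check {p : S} (hp : p ∈ R) : UpperExt.incl R p ∉ UpperExt.check R :=
  fun h => h rfl hp

/-- This makes `I^g` induced from `S`. Only antichains in `S \ R` need injectivity; every other
element of `S^R` is already a singleton. -/
theorem extend_sub_le_iSup [Finite S] (hT : IsUpperSet (UpperExt.check R))
    {U : PosetSpace k (UpperExt R)} {I : PosetSpace k (UpperExt.check R)}
    (g : (res k (subposet (UpperExt.check R))).obj U ⟶ I) (hI : IsInjective I) (A : UpperExt R) :
    (extend hT g).sub A ≤
      ⨆ (s : S) (_ : UpperExt.incl R s ≤ A), (extend hT g).sub (UpperExt.incl R s) := by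
  by_cases hA : A ∈ UpperExt.check R
  · have hmem : ∀ a : A.1.carrier, UpperExt.incl R a ∈ UpperExt.check R := fun a =>
      Set.singleton_subset_iff.2 (hA a.2)
    have : Nonempty A.1.carrier := A.1.nonempty.to_subtype
    have key := hI.sub_le_iSup (A := ⟨A, hA⟩)
      (a := fun a : A.1.carrier => (⟨UpperExt.incl R a, hmem a⟩ : UpperExt.check R))
      fun s => le_iff_incl_le (A := A) (B := s.1)
    rw [extend_sub_of_mem hT g hA]
    refine key.trans (iSup_le fun a => ?_)
    rw [← extend_sub_of_mem hT g (hmem a)]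
    exact le_iSup₂_of_le (f := fun s (_ : UpperExt.incl R s ≤ A) =>
      (extend hT g).sub (UpperExt.incl R s)) a.1 (le_iff_incl_le.1 le_rfl a) le_rfl
  · obtain ⟨r, -, hr⟩ := A.2.resolve_right hA
    obtain rfl : A = UpperExt.incl R r := Subtype.ext hr
    exact le_iSup₂_of_le (f := fun s (_ : UpperExt.incl R s ≤ UpperExt.incl R r) =>
      (extend hT g).sub (UpperExt.incl R s)) r le_rfl le_rfl

theorem extend_coind_sub {J : Set (UpperExt R)} (hJ : IsLowerSet J)
    (hT : IsUpperSet (UpperExt.check R)) {W : PosetSpace k J}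
    {I : PosetSpace k (UpperExt.check R)}
    (g : (res k (subposet (UpperExt.check R))).obj ((coind k (subposet J)).obj W) ⟶ I)
    {p : S} (hpR : p ∈ R) (hpJ : UpperExt.incl R p ∉ J) :
    (extend hT g).sub (UpperExt.incl R p) = LinearMap.range (resLin g) := by
  rw [extend_sub_of_notMem hT g (incl_notMem_check hpR), coind_obj_sub_of_notMem hJ W hpJ]
  exact Submodule.map_top _

/-- For a proper monomorphism from a coinduced space onto `V(p)`, the source is recovered by
restricting `E^p V`. -/
theorem nonempty_iso_res_fullPart {P : Type w} [PartialOrder P] {J : Set P} {W : PosetSpace k J}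
    {V : PosetSpace k P} {f : (coind k (subposet J)).obj W ⟶ V} (hf : IsProperMono f) {p : P}
    (hp : V.sub p = LinearMap.range (lin f)) :
    Nonempty (W ≅ (res k (subposet J)).obj ((fullPart k p).obj V)) := by
  have hf' := (isProperMono_iff f).1 hf
  let e : W.ambient ≃ₗ[k] V.sub p :=
    LinearEquiv.ofInjective (lin f) hf'.1 ≪≫ₗ LinearEquiv.ofEq _ _ hp.symm
  refine ⟨isoMk (U := W) (V := (res k (subposet J)).obj ((fullPart k p).obj V)) e fun j x => ?_⟩
  rw [← coind_obj_sub_of_mem W j]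
  exact ⟨fun hx => lin_mem f hx, fun hx => hf'.2 _ _ hx⟩

theorem idealFunctor_map_eq_zero_iff {J : Set (UpperExt R)} {p : S} {U V : PosetSpace k S}
    (α : U ⟶ V) : (idealFunctor k R J p).map α = 0 ↔ ∀ x ∈ U.sub p, lin α x = 0 := by
  have hU := ind_obj_sub (UpperExt.incl R) U p
  constructor
  · intro h x hx
    have hx' : x ∈ ((ind k (UpperExt.incl R)).obj U).sub (UpperExt.incl R p) := by rwa [hU]
    let y : ((ind k (UpperExt.incl R)).obj U).sub (UpperExt.incl R p) := ⟨x, hx'⟩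
    have hy := congrArg (fun j : (idealFunctor k R J p).obj U ⟶ (idealFunctor k R J p).obj V =>
      lin j y) h
    exact congrArg Subtype.val hy
  · intro h
    refine hom_ext_lin fun x => Subtype.ext (h (Subtype.val x) ?_)
    rw [← hU]
    exact Subtype.prop x

instance idealFunctor_additive (J : Set (UpperExt R)) (p : S) :
    (idealFunctor k R J p).Additive where
  map_add := rfl

/-- Splitting off a summand trivial at `p` does not change the image under the functor. -/
def idealFunctorIsoOfTrivial (J : Set (UpperExt R)) {p : S} {X : PosetSpace k S}
    (Y : PosetSpace k S) (hX : X.IsTrivialAt p) :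
    (idealFunctor k R J p).obj (directSum X Y) ≅ (idealFunctor k R J p).obj Y where
  hom := (idealFunctor k R J p).map (sndHom X Y)
  inv := (idealFunctor k R J p).map (inrHom X Y)
  hom_inv_id := by
    rw [← Functor.map_comp, ← sub_eq_zero, ← CategoryTheory.Functor.map_id, ← Functor.map_sub,
      idealFunctor_map_eq_zero_iff]
    rintro x ⟨hx, -⟩
    have hx0 : x.1 = 0 := by rwa [hX] at hx
    have : lin (sndHom X Y ≫ inrHom X Y) x = x := Prod.ext hx0.symm rfl
    exact sub_eq_zero.2 this
  inv_hom_id := by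
    rw [← Functor.map_comp, ← CategoryTheory.Functor.map_id]
    rfl

/-- Discarding a nonzero summand trivial at `p` lowers the dimension and keeps the image, so the
process stops. -/
theorem exists_noTrivialSummand (J : Set (UpperExt R)) (p : S) (V : PosetSpace k S) :
    ∃ V' : PosetSpace k S, noTrivialSummand k p V' ∧
      Nonempty ((idealFunctor k R J p).obj V' ≅ (idealFunctor k R J p).obj V) := by
  induction hn : Module.finrank k V.ambient using Nat.strong_induction_on generalizing V with
  | _ n ih =>
    by_cases hV : noTrivialSummand k p V
    · exact ⟨V, hV, ⟨Iso.refl _⟩⟩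
    · simp only [noTrivialSummand] at hV
      push Not at hV
      obtain ⟨X, ⟨Y, ⟨e⟩⟩, hX, hXp⟩ := hV
      have hdim : Module.finrank k V.ambient =
          Module.finrank k X.ambient + Module.finrank k Y.ambient := by
        rw [← Module.finrank_prod]
        exact LinearEquiv.finrank_eq (M := V.ambient) (N := X.ambient × Y.ambient)
          { lin e.hom with
            invFun := lin e.inv
            left_inv := lin_hom_inv e
            right_inv := lin_inv_hom e }
      have hpos : 0 < Module.finrank k X.ambient := Module.finrank_pos
      obtain ⟨V', hV', ⟨i⟩⟩ := ih _ (by omega) Y rfl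
      exact ⟨V', hV', ⟨i ≪≫ (idealFunctorIsoOfTrivial J Y hXp).symm ≪≫
        (idealFunctor k R J p).mapIso e.symm⟩⟩

/-- A space and its induced space have the same endomorphisms and the same subspace at `t`, and the
criterion `noTrivialSummand_iff` sees nothing else. -/
theorem noTrivialSummand_ind_iff {T P : Type*} [PartialOrder T] [PartialOrder P] {i : T ↪o P}
    {t : T} {V : PosetSpace k T} :
    noTrivialSummand k (i t) ((ind k i).obj V) ↔ noTrivialSummand k t V := by
  rw [noTrivialSummand_iff, noTrivialSummand_iff, ind_obj_sub]
  refine ⟨fun h θ => h ((ind k i).map θ), fun h θ hθ => ?_⟩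
  refine h (homMk (U := V) (V := V) (lin (U := (ind k i).obj V) (V := (ind k i).obj V) θ)
    fun s x hx => ?_) hθ
  have hs := ind_obj_sub i V s
  have hx' : x ∈ ((ind k i).obj V).sub (i s) := by rwa [hs]
  have := lin_mem θ hx'
  rwa [hs] at this

end upperExt

end PosetSpace

/-! ### The proposition -/

theorem proposition5p6 {k : Type u} [Field k] {S : Type w} [PartialOrder S] [Finite S]
    (R : Set S) (hR : IsLowerSet R) (hw : posetWidth {s : S // s ∉ R} ≤ 2)
    (J : Set (UpperExt R)) (hJ : IsLowerSet J)
    (p : S) (hpR : p ∈ R) (hpJ : UpperExt.incl R p ∉ J) :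
    (∀ (W : PosetSpace k J) (I : PosetSpace k (UpperExt.check R))
      (g : (res k (subposet (UpperExt.check R))).obj ((coind k (subposet J)).obj W) ⟶ I),
      IsProperMono g → IsInjective I →
      -- (a)
      (IsProperMono (extendHom (UpperExt.isUpperSet_check hR) g) ∧
        (∃ h : (res k (subposet (UpperExt.check R))).obj
            (extend (UpperExt.isUpperSet_check hR) g) = I,
          (res k (subposet (UpperExt.check R))).map
            (extendHom (UpperExt.isUpperSet_check hR) g) ≫ eqToHom h = g) ∧
        (∃ h : extendHom (UpperExt.isUpperSet_check hR) g ≫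
            quotProj (UpperExt.incl R p) (extend (UpperExt.isUpperSet_check hR) g) = 0,
          Nonempty (IsColimit (CokernelCofork.ofπ
            (quotProj (UpperExt.incl R p) (extend (UpperExt.isUpperSet_check hR) g)) h)) ∧
          Nonempty (IsLimit (KernelFork.ofι
            (extendHom (UpperExt.isUpperSet_check hR) g) h)))) ∧
      -- (b): existence and uniqueness of `V`, and the description of `W`
      (∃ V : PosetSpace k S, Nonempty
        (extend (UpperExt.isUpperSet_check hR) g ≅ (ind k (UpperExt.incl R)).obj V)) ∧
      (∀ V V' : PosetSpace k S,
        Nonempty (extend (UpperExt.isUpperSet_check hR) g ≅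
          (ind k (UpperExt.incl R)).obj V) →
        Nonempty (extend (UpperExt.isUpperSet_check hR) g ≅
          (ind k (UpperExt.incl R)).obj V') →
        Nonempty (V ≅ V')) ∧
      (∀ V : PosetSpace k S,
        Nonempty (extend (UpperExt.isUpperSet_check hR) g ≅
          (ind k (UpperExt.incl R)).obj V) →
        Nonempty (W ≅ (idealFunctor k R J p).obj V) ∧
        -- (d), first part
        (IsInjectiveEnvelope g ↔ noTrivialSummand k p V))) ∧
    -- (c)
    (∀ (U V : PosetSpace k S) (α : U ⟶ V),
      (idealFunctor k R J p).map α = 0 ↔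
        ∃ X : PosetSpace k S, X.IsTrivialAt p ∧ FactorsThrough α X) ∧
    -- (d), second part
    (idealFunctor k R J p).Additive ∧
    ((noTrivialSummand k p).ι ⋙ idealFunctor k R J p).EssSurj := by
  have hT := UpperExt.isUpperSet_check hR
  have main : ∀ (W : PosetSpace k J) (I : PosetSpace k (UpperExt.check R))
      (g : (res k (subposet (UpperExt.check R))).obj ((coind k (subposet J)).obj W) ⟶ I),
      IsProperMono g → IsInjective I →
      ∃ V : PosetSpace k S, Nonempty (extend hT g ≅ (ind k (UpperExt.incl R)).obj V) :=
    fun W I g hg hI => ⟨_, ⟨isoIndRes (UpperExt.incl R) (extend hT g)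
      (extend_sub_le_iSup hT g hI)⟩⟩
  have hW : ∀ (W : PosetSpace k J) (I : PosetSpace k (UpperExt.check R))
      (g : (res k (subposet (UpperExt.check R))).obj ((coind k (subposet J)).obj W) ⟶ I),
      IsProperMono g → ∀ V : PosetSpace k S,
        Nonempty (extend hT g ≅ (ind k (UpperExt.incl R)).obj V) →
        Nonempty (W ≅ (idealFunctor k R J p).obj V) := by
    rintro W I g hg V ⟨e⟩
    obtain ⟨i⟩ := nonempty_iso_res_fullPart (isProperMono_extendHom hT g hg)
      (extend_coind_sub hJ hT g hpR hpJ)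
    exact ⟨i ≪≫ (fullPart k (UpperExt.incl R p) ⋙ res k (subposet J)).mapIso e⟩
  refine ⟨fun W I g hg hI => ⟨⟨isProperMono_extendHom hT g hg, res_extend hT g, ?_⟩,
    main W I g hg hI, ?_, fun V hV => ⟨hW W I g hg V hV, ?_⟩⟩, fun U V α => ?_,
    inferInstance, ⟨fun W => ?_⟩⟩
  · have hp := extend_coind_sub hJ hT g hpR hpJ
    obtain ⟨h, hc⟩ := exists_isColimit_quotProj (f := extendHom hT g) hp
    exact ⟨h, hc, nonempty_isLimit_kernelFork (isProperMono_extendHom hT g hg) hp h⟩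
  -- Uniqueness: restricting an isomorphism of induced spaces to `S` gives one between `V` and `V'`.
  · rintro V V' ⟨e⟩ ⟨e'⟩
    exact ⟨(resIndIso _ V).symm ≪≫ (res k (UpperExt.incl R)).mapIso (e.symm ≪≫ e') ≪≫
      resIndIso _ V'⟩
  · obtain ⟨e⟩ := hV
    rw [isInjectiveEnvelope_iff hT g hg hI (extend_coind_sub hJ hT g hpR hpJ),
      ← noTrivialSummand_ind_iff (i := UpperExt.incl R) (t := p) (V := V)]
    exact ⟨noTrivialSummand_of_iso e, noTrivialSummand_of_iso e.symm⟩
  · rw [idealFunctor_map_eq_zero_iff, factorsThrough_trivial_iff]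
  · obtain ⟨I, g, hg, hI⟩ := exists_isProperMono_isInjective
      ((res k (subposet (UpperExt.check R))).obj ((coind k (subposet J)).obj W))
    obtain ⟨V, hV⟩ := main W I g hg hI
    obtain ⟨i⟩ := hW W I g hg V hV
    obtain ⟨V', hV', ⟨e⟩⟩ := exists_noTrivialSummand J p V
    exact ⟨⟨V', hV'⟩, ⟨e ≪≫ i.symm⟩⟩
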